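/- Let $\mathbb K$ be an infinite field, $R=\mathbb K[x_0,\dots,x_n]$ the standard graded polynomial ring, and let $a,b,n,s$ be positive integers with $s\ge n+1$ and $b(s-n)+1\le a\le sb$. Let $\mathcal F=\{f_1,\dots,f_s\}$ be a set of forms in $R$ of a common degree $d$ that is generic, meaning that every subset of $\mathcal F$ with at most $n+1$ elements forms a regular sequence. Put $$I_a(\mathcal F^b)=\Big\langle f_1^{e_1}\cdots f_s^{e_s} : 0\le e_i\le b \text{ for each } i,\ \sum_{i=1}^s e_i=a\Big\rangle,$$ and for an ideal $I$ of $R$ and a positive integer $m$ define the $m$-th $*$-symbolic power $$I^{(m)_*}=\bigcap_{\mathfrak p\in\operatorname{Min}(I)}\big(I^mR_{\mathfrak p}\cap R\big),$$ where $\operatorname{Min}(I)$ is the set of minimal primes of $I$. Then the following statements are equivalent: (a) $I_a(\mathcal F^b)^m\nsubseteq\langle f_1,\dots,f_s\rangle\, I_a(\mathcal F^b)^{(m)_*}$ for all positive integers $m$; (b) $I_a(\mathcal F^b)^m\nsubseteq\langle f_1,\dots,f_s\rangle\, I_a(\mathcal F^b)^{(m)_*}$ for some positive integer $m$; (c) $a$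 is a multiple of $b$. -/

import Mathlib

/-- A family `f` of elements of `R` is `c`-generic if any subfamily of size at most `c + 1` forms
a regular sequence (in any order; for homogeneous polynomials the order is irrelevant). -/
def IsCGeneric {R : Type*} [CommRing R] {s : ℕ} (c : ℕ) (f : Fin s → R) : Prop :=
  ∀ l : List (Fin s), l.Nodup → l.length ≤ c + 1 → RingTheory.Sequence.IsRegular R (l.map f)

/-- The `a`-fold product ideal `I_a(f_1^{m_1} ⋯ f_s^{m_s})`, generated by the products
`f_1^{e_1} ⋯ f_s^{e_s}` with `0 ≤ e_i ≤ m_i` for each `i` and `e_1 + ⋯ + e_s = a`. -/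
def foldProductIdeal {R : Type*} [CommRing R] {s : ℕ} (f : Fin s → R) (mult : Fin s → ℕ)
    (a : ℕ) : Ideal R :=
  Ideal.span {g | ∃ e : Fin s → ℕ, (∀ i, e i ≤ mult i) ∧ ∑ i, e i = a ∧ g = ∏ i, f i ^ e i}

/-- The uniform `a`-fold product ideal `I_a(F^b) = I_a(f_1^b ⋯ f_s^b)`. -/
def uniformFoldProductIdeal {R : Type*} [CommRing R] {s : ℕ} (f : Fin s → R) (b a : ℕ) :
    Ideal R :=
  foldProductIdeal f (fun _ => b) a

/-- The `m`-th `*`-symbolic power of `I`: the intersection of the ideals `I^m R_p ∩ R`, where `p`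
runs over the minimal primes of `I` only. -/
noncomputable def starSymbolicPower {R : Type*} [CommRing R] (I : Ideal R) (m : ℕ) : Ideal R :=
  ⨅ (p : PrimeSpectrum R) (_ : p.asIdeal ∈ I.minimalPrimes),
    ((I ^ m).map (algebraMap R (Localization.AtPrime p.asIdeal))).comap
      (algebraMap R (Localization.AtPrime p.asIdeal))

/-! ### Colon ideals and powers of a nonzerodivisor -/

section Colon

variable {R : Type*} [CommRing R]

/-! Write `s * b - a = b * c + r` with `r < b`; then `c + 1 ≤ n`. Let `I` be the fold product ideal.
Every minimal prime of `I` contains exactly `c + 1` of the `f i`, say those in `T`. There the others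
are units and `I` becomes the power `b - r` of `(f i : i ∈ T)`. Hence a product of the `f i` lies in
the `m`-th `*`-symbolic power once its exponents sum to at least `m * (b - r)` on every `(c +
1)`-subset.

If `r ≠ 0`, one factor can be removed from each generator of `I ^ m` without breaking these
inequalities, which gives the containment.

If `r = 0`, fix `Z` with `c` elements. Modulo `(f i : i ∈ Z)`, both `I ^ m` and the symbolic power
lie in the principal ideal of `g = ∏ j ∈ Zᶜ, f j ^ (m * b)`, and `g` itself comes from `I ^ m`.
Containment would give `g = μ * g` with `μ ∈ (f)`; cancelling `g` contradicts degrees. The bound on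
the symbolic power rests on unmixedness: ideals generated by at most `n + 1` of the `f i` have no
embedded primes. -/

theorem exists_prime_ge_colon [IsNoetherianRing R] {I : Ideal R} {w : R} (hw : w ∉ I) :
    ∃ q : Ideal R, q.IsPrime ∧ (∀ r, r * w ∈ I → r ∈ q) ∧ ∃ v, ∀ r, r ∈ q ↔ r * v ∈ I := by
  have hw' : (Ideal.Quotient.mk I w) ≠ 0 := by
    rwa [Ne, Ideal.Quotient.eq_zero_iff_mem]
  obtain ⟨P, hP, hle⟩ := exists_le_isAssociatedPrime_of_isNoetherianRing R _ hw'
  obtain ⟨hprime, v, hv⟩ := isAssociatedPrime_iff.1 hP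
  obtain ⟨v, rfl⟩ := Ideal.Quotient.mk_surjective v
  have key : ∀ u r : R, r • Ideal.Quotient.mk I u = 0 ↔ r * u ∈ I := fun u r => by
    rw [← Ideal.Quotient.eq_zero_iff_mem, map_mul]; rfl
  refine ⟨P, hprime, fun r hr => hle ?_, v, fun r => ?_⟩
  · rw [Submodule.mem_colon_singleton, Submodule.mem_bot, key]; exact hr
  · rw [hv, Submodule.mem_colon_singleton, Submodule.mem_bot, key]

/-- Minimal primes are associated, so they consist of zero divisors modulo `I`. -/
theorem notMem_of_mem_minimalPrimes [IsNoetherianRing R] {I p : Ideal R} (hp : p ∈ I.minimalPrimes)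
    {y : R} (hy : ∀ x, y * x ∈ I → x ∈ I) : y ∉ p := by
  intro hyp
  have h := Module.associatedPrimes.minimalPrimes_annihilator_subset_associatedPrimes R (R ⧸ I)
  rw [Ideal.annihilator_quotient] at h
  obtain ⟨hprime, v, hv⟩ := isAssociatedPrime_iff.1 (h hp)
  obtain ⟨v, rfl⟩ := Ideal.Quotient.mk_surjective v
  have key : ∀ r : R, r ∈ p ↔ r * v ∈ I := fun r => by
    rw [hv, Submodule.mem_colon_singleton, Submodule.mem_bot, ← Ideal.Quotient.eq_zero_iff_mem,
      map_mul]; rfl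
  refine hprime.ne_top ((Ideal.eq_top_iff_one _).2 ?_)
  rw [key, one_mul]
  exact hy v ((key y).1 hyp)

theorem mem_of_pow_mul_mem {I : Ideal R} {y : R} (hy : ∀ x, y * x ∈ I → x ∈ I) (k : ℕ) {x : R}
    (hx : y ^ k * x ∈ I) : x ∈ I := by
  induction k with
  | zero => simpa using hx
  | succ k ih => exact ih (hy _ (by rwa [pow_succ', mul_assoc] at hx))

theorem mem_sup_span_singleton_iff {I : Ideal R} {x y : R} :
    x ∈ I ⊔ Ideal.span {y} ↔ ∃ v, x - y * v ∈ I := by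
  rw [sup_comm, Ideal.mem_span_singleton_sup]
  constructor
  · rintro ⟨v, i, hi, rfl⟩
    exact ⟨v, by convert hi using 1; ring⟩
  · rintro ⟨v, hv⟩
    exact ⟨v, _, hv, by ring⟩

theorem exists_lt_sub_pow_mul_mem {I : Ideal R} {x y : R} {t : ℕ}
    (hx : x ∉ I ⊔ Ideal.span {y ^ t}) :
    ∃ k < t, ∃ v, x - y ^ k * v ∈ I ∧ v ∉ I ⊔ Ideal.span {y} := by
  induction t with
  | zero => simp at hx
  | succ t ih =>
    by_cases h : x ∈ I ⊔ Ideal.span {y ^ t}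
    · obtain ⟨v, hv⟩ := mem_sup_span_singleton_iff.1 h
      refine ⟨t, t.lt_succ_self, v, hv, fun hvI => hx ?_⟩
      obtain ⟨u, hu⟩ := mem_sup_span_singleton_iff.1 hvI
      refine mem_sup_span_singleton_iff.2 ⟨u, ?_⟩
      convert I.add_mem hv (I.mul_mem_left (y ^ t) hu) using 1
      ring
    · obtain ⟨k, hk, hv⟩ := ih h
      exact ⟨k, hk.trans t.lt_succ_self, hv⟩

/-- Write `x` as `y ^ k * v` modulo `I` with `k < t` and `y` not dividing `v`, then cancel `y ^ k`.
Questions about primes over `(I, y ^ t)` thus reduce to `(I, y)`. -/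
theorem exists_forall_mul_mem_sup_span {I : Ideal R} {x y : R} (hy : ∀ x, y * x ∈ I → x ∈ I)
    {t : ℕ} (hx : x ∉ I ⊔ Ideal.span {y ^ t}) :
    ∃ v ∉ I ⊔ Ideal.span {y},
      ∀ r, r * x ∈ I ⊔ Ideal.span {y ^ t} → r * v ∈ I ⊔ Ideal.span {y} := by
  obtain ⟨k, hk, v, hv, hvI⟩ := exists_lt_sub_pow_mul_mem hx
  refine ⟨v, hvI, fun r hr => ?_⟩
  obtain ⟨j, rfl⟩ := Nat.exists_eq_add_of_lt hk
  obtain ⟨u, hu⟩ := mem_sup_span_singleton_iff.1 hr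
  refine mem_sup_span_singleton_iff.2 ⟨y ^ j * u, mem_of_pow_mul_mem hy k ?_⟩
  convert I.sub_mem hu (I.mul_mem_left r hv) using 1
  ring

theorem mem_of_prod_mul_mem {ι : Type*} {I : Ideal R} {g : ι → R} (S : Finset ι)
    (hg : ∀ j ∈ S, ∀ x, g j * x ∈ I → x ∈ I) {x : R} (hx : (∏ j ∈ S, g j) * x ∈ I) : x ∈ I := by
  classical
  induction S using Finset.induction_on with
  | empty => simpa using hx
  | insert i S hi ih =>
    rw [Finset.prod_insert hi, mul_assoc] at hx
    exact ih (fun j hj => hg j (Finset.mem_insert_of_mem hj))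
      (hg i (Finset.mem_insert_self _ _) _ hx)

end Colon

/-! ### Associated primes of homogeneous ideals -/

section Graded

open MvPolynomial

attribute [local instance] MvPolynomial.gradedAlgebra

variable {K σ : Type*} [Field K]

/-- A graded Krull intersection: a multiple of `y ^ (e + 1)` has no component in degree `e`, since
`d * (e + 1) > e`. -/
theorem mem_of_forall_mem_sup_span_pow {I : Ideal (MvPolynomial σ K)}
    (hI : I.IsHomogeneous (homogeneousSubmodule σ K)) {y : MvPolynomial σ K} {d : ℕ}
    (hd : d ≠ 0) (hy : y.IsHomogeneous d) {w : MvPolynomial σ K}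
    (h : ∀ k, w ∈ I ⊔ Ideal.span {y ^ k}) : w ∈ I := by
  rw [← sum_homogeneousComponent w]
  refine Ideal.sum_mem _ fun e he => ?_
  obtain ⟨v, hv⟩ : ∃ v, w - y ^ (e + 1) * v ∈ I := by
    obtain ⟨i, hi, j, hj, rfl⟩ := Submodule.mem_sup.1 (h (e + 1))
    obtain ⟨v, rfl⟩ := Ideal.mem_span_singleton'.1 hj
    exact ⟨v, by simpa [mul_comm] using hi⟩
  have h1 : homogeneousComponent e (w - y ^ (e + 1) * v) ∈ I :=
    (mem_iff_homogeneousComponent_mem hI _).1 hv e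
  have h2 : homogeneousComponent e (y ^ (e + 1) * v) = 0 := by
    have := DirectSum.coe_decompose_mul_of_left_mem_of_not_le (homogeneousSubmodule σ K)
      (a := y ^ (e + 1)) (b := v) (i := d * (e + 1)) (n := e) (hy.pow _) (by
        have := Nat.le_mul_of_pos_left (e + 1) (Nat.pos_of_ne_zero hd); omega)
    rwa [← decomposition.decompose'_apply]
  rwa [map_sub, h2, sub_zero] at h1

theorem exists_sub_pow_mul_mem {I : Ideal (MvPolynomial σ K)}
    (hI : I.IsHomogeneous (homogeneousSubmodule σ K)) {y : MvPolynomial σ K} {d : ℕ}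
    (hd : d ≠ 0) (hy : y.IsHomogeneous d) {w : MvPolynomial σ K} (hw : w ∉ I) :
    ∃ k v, w - y ^ k * v ∈ I ∧ v ∉ I ⊔ Ideal.span {y} := by
  obtain ⟨k, hk⟩ : ∃ k, w ∉ I ⊔ Ideal.span {y ^ k} := by
    by_contra! hcon
    exact hw (mem_of_forall_mem_sup_span_pow hI hd hy hcon)
  obtain ⟨k, -, v, hv⟩ := exists_lt_sub_pow_mul_mem hk
  exact ⟨k, v, hv⟩

/-- Associated primes of a homogeneous ideal go up along a homogeneous nonzerodivisor. -/
theorem exists_colon_prime_lt [Finite σ] {I : Ideal (MvPolynomial σ K)}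
    (hI : I.IsHomogeneous (homogeneousSubmodule σ K)) {y : MvPolynomial σ K} {d : ℕ}
    (hd : d ≠ 0) (hy : y.IsHomogeneous d) (hreg : ∀ x, y * x ∈ I → x ∈ I)
    {q : Ideal (MvPolynomial σ K)} (hq : q.IsPrime) {w : MvPolynomial σ K}
    (hw : ∀ r, r ∈ q ↔ r * w ∈ I) :
    ∃ q' : Ideal (MvPolynomial σ K), q'.IsPrime ∧ q < q' ∧
      ∃ v, ∀ r, r ∈ q' ↔ r * v ∈ I ⊔ Ideal.span {y} := by
  have hwI : w ∉ I := fun h => hq.ne_top ((Ideal.eq_top_iff_one _).2 ((hw 1).2 (by simpa)))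
  obtain ⟨k, v, hv, hvI⟩ := exists_sub_pow_mul_mem hI hd hy hwI
  obtain ⟨q', hq', hle, hass⟩ := exists_prime_ge_colon hvI
  -- The inclusion is strict because `y` lies in `q'` but, being regular modulo `I`, not in `q`.
  refine ⟨q', hq', SetLike.lt_iff_le_and_exists.2 ⟨fun r hr => hle r ?_, y, hle y ?_, ?_⟩, hass⟩
  · refine Ideal.mem_sup_left (mem_of_pow_mul_mem hreg k ?_)
    convert I.sub_mem ((hw r).1 hr) (I.mul_mem_left r hv) using 1
    ring
  · exact Ideal.mem_sup_right (Ideal.mul_mem_right _ _ (Ideal.mem_span_singleton_self _))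
  · rw [hw]
    exact fun h => hwI (hreg _ h)

end Graded

/-! ### Regularity and heights for generic families -/

section Generic

variable {R : Type*} [CommRing R] {n s : ℕ} {f : Fin s → R}

theorem IsCGeneric.mem_span_of_mul_mem (hgen : IsCGeneric n f) {A : Finset (Fin s)}
    (hA : A.card ≤ n) {i : Fin s} (hi : i ∉ A) {x : R} (hx : f i * x ∈ Ideal.span (f '' A)) :
    x ∈ Ideal.span (f '' A) := by
  have h := (hgen (A.toList ++ [i]) (by simp [List.nodup_append, A.nodup_toList, hi])
    (by simpa using hA)).regular_mod_prev A.card (by simp)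
  have hlist : Ideal.ofList (((A.toList ++ [i]).map f).take A.card) = Ideal.span (f '' A) := by
    rw [List.map_append, List.take_left' (by simp), Ideal.ofList]
    congr 1
    ext r
    simp
  have hget : ((A.toList ++ [i]).map f)[A.card]'(by simp) = f i := by
    simp
  rw [hlist, hget, smul_eq_mul, Ideal.mul_top] at h
  rw [← Ideal.Quotient.eq_zero_iff_mem]
  apply h
  simp only [smul_zero]
  exact Ideal.Quotient.eq_zero_iff_mem.2 hx

theorem IsCGeneric.card_le_height [IsNoetherianRing R] (hgen : IsCGeneric n f)
    {A : Finset (Fin s)} (hA : A.card ≤ n + 1) {p : Ideal R} [hp : p.IsPrime]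
    (hAp : Ideal.span (f '' A) ≤ p) : (A.card : ℕ∞) ≤ p.height := by
  induction A using Finset.induction_on generalizing p with
  | empty => simp
  | insert i A hi ih =>
    rw [Finset.card_insert_of_notMem hi] at hA ⊢
    have hle : Ideal.span (f '' A) ≤ Ideal.span (f '' ((insert i A : Finset (Fin s)) : Set _)) :=
      Ideal.span_mono (Set.image_mono (by simp))
    obtain ⟨q, hq, hqp⟩ := Ideal.exists_minimalPrimes_le (hle.trans hAp)
    have := hq.1.1
    have hiq := notMem_of_mem_minimalPrimes hq
      fun x => hgen.mem_span_of_mul_mem (by omega) hi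
    have hip : f i ∈ p := hAp (Ideal.subset_span ⟨i, by simp, rfl⟩)
    have hlt : q < p := lt_of_le_of_ne hqp (by rintro rfl; exact hiq hip)
    push_cast
    exact (add_le_add_left (ih (by omega) hq.1.2) 1).trans
      (Ideal.height_add_one_le_of_lt_of_isPrime hlt)

end Generic

/-! ### Unmixedness -/

section Unmixed

open MvPolynomial

attribute [local instance] MvPolynomial.gradedAlgebra

variable {K : Type*} [Field K] {n s d : ℕ} {f : Fin s → MvPolynomial (Fin (n + 1)) K}

theorem isHomogeneous_span_image (hf : ∀ i, (f i).IsHomogeneous d) (A : Set (Fin s)) :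
    (Ideal.span (f '' A)).IsHomogeneous (homogeneousSubmodule (Fin (n + 1)) K) :=
  Ideal.homogeneous_span _ _ (by rintro _ ⟨i, -, rfl⟩; exact ⟨d, hf i⟩)

/-- Each of `k` further members of the family pushes the associated prime strictly up, and heights
cannot exceed the dimension `n + 1`. -/
theorem IsCGeneric.height_add_le (hf : ∀ i, (f i).IsHomogeneous d) (hd : d ≠ 0) (hs : n + 1 ≤ s)
    (hgen : IsCGeneric n f) {k : ℕ} {A : Finset (Fin s)} (hA : A.card + k = n + 1)
    {q : Ideal (MvPolynomial (Fin (n + 1)) K)} (hq : q.IsPrime) {w : MvPolynomial (Fin (n + 1)) K}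
    (hw : ∀ r, r ∈ q ↔ r * w ∈ Ideal.span (f '' A)) : q.height + k ≤ (n + 1 : ℕ) := by
  induction k generalizing A q w with
  | zero =>
    have := Ideal.height_le_ringKrullDim_of_isPrime (I := q)
    rw [MvPolynomial.ringKrullDim_of_isNoetherianRing, ringKrullDim_eq_zero_of_field, zero_add,
      Nat.card_fin] at this
    simpa using WithBot.coe_le_coe.1 this
  | succ k ih =>
    obtain ⟨i, hi⟩ : ∃ i, i ∉ A := by
      by_contra! h
      have := Finset.card_le_card (fun i _ => h i : Finset.univ ⊆ A)
      rw [Finset.card_fin] at this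
      omega
    obtain ⟨q', hq', hlt, v, hv⟩ := exists_colon_prime_lt (isHomogeneous_span_image hf A) hd (hf i)
      (fun x => hgen.mem_span_of_mul_mem (by omega) hi) hq hw
    have := ih (A := insert i A) (by rw [Finset.card_insert_of_notMem hi]; omega) hq' (w := v) (by
      intro r
      rw [hv, Finset.coe_insert, Set.image_insert_eq, Ideal.span_insert, sup_comm])
    refine le_trans ?_ this
    rw [Nat.cast_succ, add_comm (k : ℕ∞) 1, ← add_assoc]
    exact add_le_add_left (Ideal.height_add_one_le_of_lt_of_isPrime hlt) _

/-- Ideals generated by at most `n + 1` members of a generic family are unmixed. -/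
theorem IsCGeneric.mem_minimalPrimes (hf : ∀ i, (f i).IsHomogeneous d) (hd : d ≠ 0)
    (hs : n + 1 ≤ s) (hgen : IsCGeneric n f) {A : Finset (Fin s)} (hA : A.card ≤ n + 1)
    {q : Ideal (MvPolynomial (Fin (n + 1)) K)} (hq : q.IsPrime) {w : MvPolynomial (Fin (n + 1)) K}
    (hw : ∀ r, r ∈ q ↔ r * w ∈ Ideal.span (f '' A)) :
    q ∈ (Ideal.span (f '' A)).minimalPrimes := by
  have hle : Ideal.span (f '' A) ≤ q := fun r hr => (hw r).2 (Ideal.mul_mem_right _ _ hr)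
  obtain ⟨p, hp, hpq⟩ := Ideal.exists_minimalPrimes_le hle
  have := hp.1.1
  obtain rfl | hlt := hpq.eq_or_lt
  · exact hp
  exfalso
  obtain ⟨k, hk⟩ := Nat.exists_eq_add_of_le hA
  have h1 := hgen.height_add_le hf hd hs hk.symm hq hw
  have h2 := hgen.card_le_height hA hp.1.2
  have h3 := Ideal.height_add_one_le_of_lt_of_isPrime hlt
  have h4 : ((A.card : ℕ∞) + 1) + k ≤ (n + 1 : ℕ) :=
    (add_le_add_left ((add_le_add_left h2 1).trans h3) _).trans h1
  have h5 : A.card + 1 + k ≤ n + 1 := by exact_mod_cast h4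
  omega

end Unmixed

/-! ### Minimal primes, symbolic powers, and the case `r ≠ 0` -/

section FoldProduct

theorem exists_le_sum_eq {ι : Type*} (S : Finset ι) (u : ι → ℕ) {a : ℕ} (h : a ≤ ∑ i ∈ S, u i) :
    ∃ e : ι → ℕ, (∀ i, e i ≤ u i) ∧ ∑ i ∈ S, e i = a := by
  classical
  induction a with
  | zero => exact ⟨0, by simp, by simp⟩
  | succ a ih =>
    obtain ⟨e, he, hsum⟩ := ih (by omega)
    obtain ⟨i, hi, hlt⟩ : ∃ i ∈ S, e i < u i := by
      by_contra! hcon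
      have := Finset.sum_le_sum hcon
      omega
    refine ⟨e + Pi.single i 1, fun j => ?_, ?_⟩
    · by_cases hj : j = i
      · subst hj; simpa using hlt
      · simpa [hj] using he j
    · simp [Finset.sum_add_distrib, hsum, Finset.sum_pi_single', hi]

variable {R : Type*} [CommRing R] {n s a b c r : ℕ} {f : Fin s → R}

theorem prod_mem_uniformFoldProductIdeal {e : Fin s → ℕ} (he : ∀ i, e i ≤ b)
    (hsum : ∑ i, e i = a) : ∏ i, f i ^ e i ∈ uniformFoldProductIdeal f b a :=
  Ideal.subset_span ⟨e, he, hsum, rfl⟩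

theorem uniformFoldProductIdeal_le {J : Ideal R}
    (h : ∀ e : Fin s → ℕ, (∀ i, e i ≤ b) → ∑ i, e i = a → ∏ i, f i ^ e i ∈ J) :
    uniformFoldProductIdeal f b a ≤ J :=
  Ideal.span_le.2 (by rintro _ ⟨e, he, hsum, rfl⟩; exact h e he hsum)

theorem uniformFoldProductIdeal_pow_le (m : ℕ) :
    uniformFoldProductIdeal f b a ^ m ≤ uniformFoldProductIdeal f (m * b) (m * a) := by
  induction m with
  | zero =>
    rw [pow_zero, Ideal.one_eq_top, top_le_iff, Ideal.eq_top_iff_one]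
    simpa using prod_mem_uniformFoldProductIdeal (f := f) (b := 0 * b) (a := 0 * a) (e := 0)
      (by simp) (by simp)
  | succ m ih =>
    rw [pow_succ]
    refine (Ideal.mul_mono_left ih).trans ?_
    unfold uniformFoldProductIdeal foldProductIdeal
    rw [Ideal.span_mul_span', Ideal.span_le]
    rintro _ ⟨_, ⟨e, he, hs, rfl⟩, _, ⟨e', he', hs', rfl⟩, rfl⟩
    refine Ideal.subset_span ⟨e + e', fun i => ?_, ?_, ?_⟩
    · have := he i; have := he' i
      simp only [Pi.add_apply]; linarith
    · simp only [Pi.add_apply, Finset.sum_add_distrib, hs, hs']; ring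
    · simp [pow_add, Finset.prod_mul_distrib]

theorem prod_pow_mem_span {e : Fin s → ℕ} {A : Finset (Fin s)} {i : Fin s} (hi : i ∈ A)
    (he : e i ≠ 0) : ∏ i, f i ^ e i ∈ Ideal.span (f '' A) := by
  rw [← Finset.mul_prod_erase _ _ (Finset.mem_univ i)]
  have hfi : f i ∈ Ideal.span (f '' A) := Ideal.subset_span ⟨i, hi, rfl⟩
  exact Ideal.mul_mem_right _ _ (Ideal.pow_mem_of_mem _ hfi _ (Nat.pos_of_ne_zero he))

theorem mem_starSymbolicPower {I : Ideal R} {m : ℕ} {x : R} :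
    x ∈ starSymbolicPower I m ↔ ∀ p ∈ I.minimalPrimes, ∃ u ∉ p, u * x ∈ I ^ m := by
  simp only [starSymbolicPower, Ideal.mem_iInf, Ideal.mem_comap]
  constructor
  · intro h p hp
    have hpp := hp.1.1
    have := h ⟨p, hpp⟩ hp
    rw [IsLocalization.algebraMap_mem_map_algebraMap_iff p.primeCompl] at this
    exact this
  · intro h p hp
    rw [IsLocalization.algebraMap_mem_map_algebraMap_iff p.asIdeal.primeCompl]
    exact h _ hp

/-- Partial sums of a bounded exponent vector, in terms of the deficits of the other entries. -/
theorem add_sum_compl_sub_eq_add_sum (hsum : a + b * c + r = s * b) {m : ℕ} {E : Fin s → ℕ}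
    (hE : ∀ i, E i ≤ m * b) (hEs : ∑ i, E i = m * a) {A : Finset (Fin s)} (hA : A.card = c + 1) :
    m * b + ∑ i ∈ Aᶜ, (m * b - E i) = m * r + ∑ i ∈ A, E i := by
  have h1 : ∑ i ∈ Aᶜ, (m * b - E i) + ∑ i ∈ Aᶜ, E i = Aᶜ.card * (m * b) := by
    rw [← Finset.sum_add_distrib, Finset.sum_congr rfl fun i _ => Nat.sub_add_cancel (hE i)]
    simp
  have h2 := Finset.sum_add_sum_compl A E
  have h3 : A.card + Aᶜ.card = s := by rw [Finset.card_add_card_compl, Fintype.card_fin]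
  zify at *
  have h4 : (Aᶜ.card : ℤ) = s - (c + 1) := by linarith
  rw [h4] at h1
  linear_combination h1 - h2 - hEs - m * hsum

theorem uniformFoldProductIdeal_le_span (hsum : a + b * c + r = s * b) (hr : r < b)
    {A : Finset (Fin s)} (hA : A.card = c + 1) :
    uniformFoldProductIdeal f b a ≤ Ideal.span (f '' A) := by
  refine uniformFoldProductIdeal_le fun e he hs => ?_
  have := add_sum_compl_sub_eq_add_sum (m := 1) hsum (by simpa using he) (by simpa using hs) hA
  obtain ⟨i, hi, hne⟩ := Finset.exists_ne_zero_of_sum_ne_zero (s := A) (f := e) (by omega)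
  exact prod_pow_mem_span hi hne

-- If `p` contained at most `c` of the `f i`, the others would have total capacity at least `b * (s
-- - c) ≥ a`, so some generator would avoid `p`.
open Classical in
theorem lt_card_of_uniformFoldProductIdeal_le (hsum : a + b * c + r = s * b) {p : Ideal R}
    (hp : p.IsPrime) (hle : uniformFoldProductIdeal f b a ≤ p) :
    c + 1 ≤ (Finset.univ.filter fun i => f i ∈ p).card := by
  by_contra! hlt
  set T := Finset.univ.filter fun i => f i ∈ p with hT
  have h3 : T.card + Tᶜ.card = s := by rw [Finset.card_add_card_compl, Fintype.card_fin]
  obtain ⟨e, he, hes⟩ := exists_le_sum_eq Finset.univ (fun i => if i ∈ T then 0 else b) (a := a) (by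
    rw [Finset.sum_ite, Finset.sum_const_zero, zero_add, Finset.sum_const, smul_eq_mul,
      ← Finset.compl_filter]
    have h4 : Finset.univ.filter (· ∈ T) = T := by ext; simp
    rw [h4]
    rw [← h3] at hsum
    nlinarith [Nat.mul_le_mul_left b (Nat.lt_succ_iff.1 hlt)])
  have hmem := hle (prod_mem_uniformFoldProductIdeal (f := f) (e := e)
    (fun i => (he i).trans (by split_ifs <;> simp)) hes)
  obtain ⟨i, -, hi⟩ := hp.prod_mem_iff.1 hmem
  have hiT : i ∈ T := by simpa [hT] using hp.mem_of_pow_mem _ hi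
  have h0 := he i
  simp only [hiT, if_true, Nat.le_zero] at h0
  rw [h0, pow_zero] at hi
  exact hp.ne_top ((Ideal.eq_top_iff_one _).2 hi)

open Classical in
theorem IsCGeneric.card_eq_of_mem_minimalPrimes [IsNoetherianRing R] (hgen : IsCGeneric n f)
    (hsum : a + b * c + r = s * b) (hr : r < b) (hc : c + 1 ≤ n) {p : Ideal R}
    (hp : p ∈ (uniformFoldProductIdeal f b a).minimalPrimes) :
    (Finset.univ.filter fun i => f i ∈ p).card = c + 1 := by
  have hpp := hp.1.1
  obtain ⟨A, hAT, hA⟩ := Finset.exists_subset_card_eq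
    (lt_card_of_uniformFoldProductIdeal_le hsum hpp hp.1.2)
  suffices h : Finset.univ.filter (fun i => f i ∈ p) ⊆ A by rw [hAT.antisymm h] at hA; exact hA
  intro i hi
  have hAp : Ideal.span (f '' A) ≤ p := Ideal.span_le.2 (by
    rintro _ ⟨j, hj, rfl⟩
    exact (Finset.mem_filter.1 (hAT hj)).2)
  obtain ⟨q, hq, hqp⟩ := Ideal.exists_minimalPrimes_le hAp
  obtain rfl : p = q :=
    (hp.2 ⟨hq.1.1, (uniformFoldProductIdeal_le_span hsum hr hA).trans hq.1.2⟩ hqp).antisymm hqp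
  by_contra hiA
  exact notMem_of_mem_minimalPrimes hq (fun x => hgen.mem_span_of_mul_mem (by omega) hiA)
    (Finset.mem_filter.1 hi).2

/-- Peel off `m` blocks of degree `b - r` supported on `T`; each block times `∏ i ∈ Tᶜ, f i ^ b` is
a generator. -/
theorem prod_mul_prod_compl_pow_mem (hsum : a + b * c + r = s * b) (hr : r < b)
    {T : Finset (Fin s)} (hT : T.card = c + 1) (m : ℕ) {e : Fin s → ℕ}
    (he : m * (b - r) ≤ ∑ i ∈ T, e i) :
    (∏ i ∈ T, f i ^ e i) * (∏ i ∈ Tᶜ, f i ^ b) ^ m ∈ uniformFoldProductIdeal f b a ^ m := by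
  classical
  induction m generalizing e with
  | zero => simp
  | succ m ih =>
    have hexp : (m + 1) * (b - r) = m * (b - r) + (b - r) := by ring
    obtain ⟨e', he', hs'⟩ := exists_le_sum_eq T e (a := b - r) (by omega)
    have hsub : ∑ i ∈ T, (e i - e' i) + ∑ i ∈ T, e' i = ∑ i ∈ T, e i := by
      rw [← Finset.sum_add_distrib]
      exact Finset.sum_congr rfl fun i _ => Nat.sub_add_cancel (he' i)
    have h1 := ih (e := fun i => e i - e' i) (by omega)
    have h2 : (∏ i ∈ T, f i ^ e' i) * ∏ i ∈ Tᶜ, f i ^ b ∈ uniformFoldProductIdeal f b a := by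
      have h3 : T.card + Tᶜ.card = s := by rw [Finset.card_add_card_compl, Fintype.card_fin]
      convert prod_mem_uniformFoldProductIdeal (f := f) (a := a) (b := b)
        (e := fun i => if i ∈ T then e' i else b) (fun i => ?_) ?_ using 1
      · rw [← Finset.prod_mul_prod_compl T]
        congr 1
        · exact Finset.prod_congr rfl fun i hi => by rw [if_pos hi]
        · exact Finset.prod_congr rfl fun i hi => by rw [if_neg (Finset.mem_compl.1 hi)]
      · split_ifs with hi
        · exact (Finset.single_le_sum (fun _ _ => Nat.zero_le _) hi).trans (by omega)
        · exact le_rfl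
      · rw [← Finset.sum_add_sum_compl T, Finset.sum_congr rfl fun i hi => if_pos hi, hs',
          Finset.sum_congr rfl fun i hi => if_neg (Finset.mem_compl.1 hi), Finset.sum_const,
          smul_eq_mul]
        zify [hr.le] at *
        have h4 : (Tᶜ.card : ℤ) = s - (c + 1) := by linarith
        rw [h4]
        linear_combination -hsum
    have h3 : ∏ i ∈ T, f i ^ e i = (∏ i ∈ T, f i ^ (e i - e' i)) * ∏ i ∈ T, f i ^ e' i := by
      rw [← Finset.prod_mul_distrib]
      exact Finset.prod_congr rfl fun i _ => by rw [← pow_add, Nat.sub_add_cancel (he' i)]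
    rw [pow_succ (uniformFoldProductIdeal f b a), h3, pow_succ]
    convert Ideal.mul_mem_mul h1 h2 using 1
    ring

theorem IsCGeneric.prod_mem_starSymbolicPower [IsNoetherianRing R] (hgen : IsCGeneric n f)
    (hsum : a + b * c + r = s * b) (hr : r < b) (hc : c + 1 ≤ n) {m : ℕ} {e : Fin s → ℕ}
    (he : ∀ A : Finset (Fin s), A.card = c + 1 → m * (b - r) ≤ ∑ i ∈ A, e i) :
    ∏ i, f i ^ e i ∈ starSymbolicPower (uniformFoldProductIdeal f b a) m := by
  classical
  refine mem_starSymbolicPower.2 fun p hp => ?_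
  have hpp := hp.1.1
  set T := Finset.univ.filter fun i => f i ∈ p with hTdef
  have hT : T.card = c + 1 := hgen.card_eq_of_mem_minimalPrimes hsum hr hc hp
  refine ⟨(∏ i ∈ Tᶜ, f i ^ b) ^ m, fun hmem => ?_, ?_⟩
  · obtain ⟨i, hi, hip⟩ := hpp.prod_mem_iff.1 (hpp.mem_of_pow_mem _ hmem)
    exact Finset.mem_compl.1 hi (by simpa [hTdef] using hpp.mem_of_pow_mem _ hip)
  · rw [← Finset.prod_mul_prod_compl T]
    convert Ideal.mul_mem_right (∏ i ∈ Tᶜ, f i ^ e i) _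
      (prod_mul_prod_compl_pow_mem (f := f) hsum hr hT m (he T hT)) using 1
    ring

theorem IsCGeneric.pow_le_mul_starSymbolicPower [IsNoetherianRing R] (hgen : IsCGeneric n f)
    (hsum : a + b * c + r = s * b) (hr : r < b) (hr0 : r ≠ 0) (hc : c + 1 ≤ n) (hs : n < s)
    (ha : a ≠ 0) {m : ℕ} (hm : m ≠ 0) :
    uniformFoldProductIdeal f b a ^ m ≤
      Ideal.span (Set.range f) * starSymbolicPower (uniformFoldProductIdeal f b a) m := by
  classical
  refine (uniformFoldProductIdeal_pow_le m).trans (uniformFoldProductIdeal_le fun E hE hEs => ?_)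
  have hmb : m * (b - r) + m * r = m * b := by rw [← mul_add, Nat.sub_add_cancel hr.le]
  have hmr : m * r ≠ 0 := mul_ne_zero hm hr0
  have hle (A : Finset (Fin s)) (hA : A.card = c + 1) : m * (b - r) ≤ ∑ i ∈ A, E i := by
    have := add_sum_compl_sub_eq_add_sum hsum hE hEs hA
    omega
  -- Seek an exponent that can drop by one. If some `A` attains the bound, the deficits off `A`
  -- vanish, so any `i ∉ A` has `E i = m * b > m * (b - r)`. If none does, any nonzero exponent
  -- works.
  obtain ⟨i, hi0, hi⟩ : ∃ i, E i ≠ 0 ∧ ∀ A : Finset (Fin s), A.card = c + 1 → i ∈ A →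
      m * (b - r) + 1 ≤ ∑ i ∈ A, E i := by
    by_cases h : ∃ A : Finset (Fin s), A.card = c + 1 ∧ ∑ i ∈ A, E i = m * (b - r)
    · obtain ⟨A, hA, hAeq⟩ := h
      obtain ⟨i, hiA⟩ : ∃ i, i ∈ Aᶜ := by
        rw [← Finset.Nonempty, ← Finset.card_pos, Finset.card_compl, Fintype.card_fin]
        omega
      have h1 := add_sum_compl_sub_eq_add_sum hsum hE hEs hA
      have h2 : ∑ i ∈ Aᶜ, (m * b - E i) = 0 := by omega
      have h3 := Finset.sum_eq_zero_iff.1 h2 i hiA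
      refine ⟨i, by omega, fun A' _ hiA' => ?_⟩
      have h4 := Finset.single_le_sum (f := E) (fun _ _ => Nat.zero_le _) hiA'
      omega
    · push Not at h
      obtain ⟨i, -, hi⟩ := Finset.exists_ne_zero_of_sum_ne_zero
        (s := Finset.univ) (f := E) (by rw [hEs]; exact mul_ne_zero hm ha)
      exact ⟨i, hi, fun A hA _ => lt_of_le_of_ne (hle A hA) (h A hA).symm⟩
  obtain ⟨E', hsplit⟩ : ∃ E' : Fin s → ℕ, E = E' + Pi.single i 1 := by
    refine ⟨E - Pi.single i 1, ?_⟩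
    funext j
    by_cases hj : j = i
    · subst hj; simp; omega
    · simp [hj]
  have hprod : ∏ j, f j ^ E j = f i * ∏ j, f j ^ E' j := by
    conv_lhs => rw [hsplit]
    simp only [Pi.add_apply, pow_add, Finset.prod_mul_distrib]
    rw [mul_comm]
    congr 1
    rw [Finset.prod_eq_single i (fun j _ hj => by simp [hj]) (by simp)]
    simp
  rw [hprod]
  refine Ideal.mul_mem_mul (Ideal.subset_span ⟨i, rfl⟩)
    (hgen.prod_mem_starSymbolicPower hsum hr hc fun A hA => ?_)
  have h1 : ∑ j ∈ A, E j = ∑ j ∈ A, E' j + ∑ j ∈ A, Pi.single i 1 j := by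
    rw [← Finset.sum_add_distrib]
    exact Finset.sum_congr rfl fun j _ => congrFun hsplit j
  rw [Finset.sum_pi_single'] at h1
  split_ifs at h1 with hiA
  · have := hi A hA hiA; omega
  · have := hle A hA; omega

end FoldProduct

/-! ### The case `r = 0`: reduction modulo `c` of the forms -/

section Generators

variable {R : Type*} [CommRing R] {s a b c : ℕ} {f : Fin s → R}

theorem uniformFoldProductIdeal_pow_le_sup (hsum : a + b * c = s * b) {Z : Finset (Fin s)}
    (hZ : Z.card = c) (m : ℕ) :
    uniformFoldProductIdeal f b a ^ m ≤
      Ideal.span (f '' Z) ⊔ Ideal.span {∏ j ∈ Zᶜ, f j ^ (m * b)} := by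
  refine (uniformFoldProductIdeal_pow_le m).trans (uniformFoldProductIdeal_le fun E hE hEs => ?_)
  by_cases h : ∃ i ∈ Z, E i ≠ 0
  · obtain ⟨i, hi, h0⟩ := h
    exact Ideal.mem_sup_left (prod_pow_mem_span hi h0)
  push Not at h
  have h3 : Z.card + Zᶜ.card = s := by rw [Finset.card_add_card_compl, Fintype.card_fin]
  -- With no exponent on `Z`, the degree `m * a = (s - c) * (m * b)` is the maximum possible, so
  -- every remaining exponent is `m * b`.
  have h1 : ∑ i ∈ Zᶜ, E i = ∑ i ∈ Zᶜ, m * b := by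
    rw [← Finset.sum_add_sum_compl Z, Finset.sum_eq_zero h, zero_add] at hEs
    rw [hEs, Finset.sum_const, smul_eq_mul]
    rw [← h3, hZ] at hsum
    have : a = Zᶜ.card * b := by linarith
    rw [this]; ring
  have h2 := (Finset.sum_eq_sum_iff_of_le fun i _ => hE i).1 h1
  refine Ideal.mem_sup_right (Ideal.mem_span_singleton.2 (dvd_of_eq ?_))
  rw [← Finset.prod_mul_prod_compl Z (fun i => f i ^ E i),
    Finset.prod_eq_one (s := Z) fun i hi => by rw [h i hi, pow_zero], one_mul]
  exact Finset.prod_congr rfl fun i hi => by rw [h2 i hi]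

theorem prod_compl_mem_uniformFoldProductIdeal (hsum : a + b * c = s * b) {Z : Finset (Fin s)}
    (hZ : Z.card = c) : ∏ j ∈ Zᶜ, f j ^ b ∈ uniformFoldProductIdeal f b a := by
  classical
  have h3 : Z.card + Zᶜ.card = s := by rw [Finset.card_add_card_compl, Fintype.card_fin]
  convert prod_mem_uniformFoldProductIdeal (f := f) (a := a) (b := b)
    (e := fun i => if i ∈ Z then 0 else b) (fun i => by split_ifs <;> simp) ?_ using 1
  · rw [← Finset.prod_mul_prod_compl Z, Finset.prod_eq_one (s := Z) fun i hi => by simp [hi],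
      one_mul]
    exact Finset.prod_congr rfl fun i hi => by rw [if_neg (Finset.mem_compl.1 hi)]
  · rw [← Finset.sum_add_sum_compl Z, Finset.sum_eq_zero (s := Z) fun i hi => by simp [hi],
      Finset.sum_congr rfl fun i hi => if_neg (Finset.mem_compl.1 hi), Finset.sum_const,
      smul_eq_mul]
    rw [← h3, hZ] at hsum
    linarith

end Generators

/-! ### Bounding the symbolic power, and the equivalence -/

section Main

open MvPolynomial

variable {K : Type*} [Field K] {n s d a b c : ℕ} {f : Fin s → MvPolynomial (Fin (n + 1)) K}

theorem IsCGeneric.degree_ne_zero (hf : ∀ i, (f i).IsHomogeneous d) (hs : n + 1 ≤ s)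
    (hgen : IsCGeneric n f) : d ≠ 0 := by
  rintro rfl
  let i : Fin s := ⟨0, by omega⟩
  have hC : f i = C (coeff 0 (f i)) :=
    totalDegree_eq_zero_iff_eq_C.1 ((totalDegree_zero_iff_isHomogeneous _).2 (hf i))
  by_cases h0 : f i = 0
  · have := hgen.mem_span_of_mul_mem (A := ∅) (by simp) (Finset.notMem_empty i) (x := 1)
      (by simp [h0])
    simp at this
  · have hne := (hgen [i] (by simp) (by simp)).top_ne_smul
    refine hne ?_
    have hunit : IsUnit (f i) := by
      rw [hC]
      refine IsUnit.map C (isUnit_iff_ne_zero.2 fun h => h0 ?_)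
      rw [hC, h, map_zero]
    rw [List.map_singleton, Ideal.ofList_singleton, Ideal.span_singleton_eq_top.2 hunit]
    simp

/-- Otherwise the multipliers taking `x` into `I ^ m` lie in an associated prime `q` of `(f i : i ∈
Z ∪ {j})`. By unmixedness and the count of forms, `q` is a minimal prime of `I`, where `x` has a
multiplier outside `q`. -/
theorem IsCGeneric.mem_sup_span_pow_of_mem_starSymbolicPower (hf : ∀ i, (f i).IsHomogeneous d)
    (hs : n + 1 ≤ s) (hgen : IsCGeneric n f) (hb : b ≠ 0) (hc : c + 1 ≤ n)
    (hsum : a + b * c = s * b) {Z : Finset (Fin s)} (hZ : Z.card = c) {j : Fin s} (hj : j ∉ Z)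
    {m : ℕ} {x : MvPolynomial (Fin (n + 1)) K}
    (hx : x ∈ starSymbolicPower (uniformFoldProductIdeal f b a) m) :
    x ∈ Ideal.span (f '' Z) ⊔ Ideal.span {f j ^ (m * b)} := by
  classical
  by_contra hxN
  have hI : uniformFoldProductIdeal f b a ^ m ≤
      Ideal.span (f '' Z) ⊔ Ideal.span {f j ^ (m * b)} :=
    (uniformFoldProductIdeal_pow_le_sup hsum hZ m).trans (sup_le_sup_left
      (Ideal.span_singleton_le_span_singleton.2
        (Finset.dvd_prod_of_mem _ (Finset.mem_compl.2 hj))) _)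
  obtain ⟨v, hv, hle⟩ := exists_forall_mul_mem_sup_span
    (fun y => hgen.mem_span_of_mul_mem (by omega) hj) hxN
  have hA : (insert j Z).card = c + 1 := by rw [Finset.card_insert_of_notMem hj, hZ]
  have hspan : Ideal.span (f '' Z) ⊔ Ideal.span {f j} =
      Ideal.span (f '' (insert j Z : Finset (Fin s))) := by
    rw [Finset.coe_insert, Set.image_insert_eq, Ideal.span_insert, sup_comm]
  rw [hspan] at hv hle
  obtain ⟨q, hq, hcol, w, hw⟩ := exists_prime_ge_colon hv
  have hqmin := hgen.mem_minimalPrimes hf (hgen.degree_ne_zero hf hs) hs (by omega) hq hw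
  have hcolx (u) (hu : u * x ∈ uniformFoldProductIdeal f b a ^ m) : u ∈ q :=
    hcol u (hle u (hI hu))
  have hIq : uniformFoldProductIdeal f b a ≤ q := fun g hg =>
    hq.mem_of_pow_mem m (hcolx _ (Ideal.mul_mem_right _ _ (Ideal.pow_mem_pow hg m)))
  obtain ⟨p, hp, hpq⟩ := Ideal.exists_minimalPrimes_le hIq
  have hcard := hgen.card_eq_of_mem_minimalPrimes (r := 0) hsum (Nat.pos_of_ne_zero hb) hc hp
  have hsub : (Finset.univ.filter fun i => f i ∈ p) ⊆ insert j Z := by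
    intro i hi
    by_contra hiA
    exact notMem_of_mem_minimalPrimes hqmin (fun x => hgen.mem_span_of_mul_mem (by omega) hiA)
      (hpq (Finset.mem_filter.1 hi).2)
  have heq := Finset.eq_of_subset_of_card_le hsub (by rw [hcard, hA])
  have hAp : Ideal.span (f '' (insert j Z : Finset (Fin s))) ≤ p := Ideal.span_le.2 (by
    rw [← heq]
    rintro _ ⟨i, hi, rfl⟩
    exact (Finset.mem_filter.1 hi).2)
  obtain ⟨u, hu, hux⟩ := mem_starSymbolicPower.1 hx p hp
  exact hu (hqmin.2 ⟨hp.1.1, hAp⟩ hpq (hcolx u hux))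

/-- The separate divisibilities by `f j ^ (m * b)` multiply together because, modulo `Z`, each `f j`
is regular modulo powers of any other `f k`. -/
theorem IsCGeneric.starSymbolicPower_le_sup (hf : ∀ i, (f i).IsHomogeneous d)
    (hs : n + 1 ≤ s) (hgen : IsCGeneric n f) (hb : b ≠ 0) (hc : c + 1 ≤ n)
    (hsum : a + b * c = s * b) {Z : Finset (Fin s)} (hZ : Z.card = c) (m : ℕ) :
    starSymbolicPower (uniformFoldProductIdeal f b a) m ≤
      Ideal.span (f '' Z) ⊔ Ideal.span {∏ j ∈ Zᶜ, f j ^ (m * b)} := by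
  classical
  intro x hx
  have hreg (j k : Fin s) (hj : j ∉ Z) (hk : k ∉ Z) (hjk : j ≠ k) (y)
      (hy : f j * y ∈ Ideal.span (f '' Z) ⊔ Ideal.span {f k ^ (m * b)}) :
      y ∈ Ideal.span (f '' Z) ⊔ Ideal.span {f k ^ (m * b)} := by
    by_contra hcon
    obtain ⟨v, hv, hle⟩ := exists_forall_mul_mem_sup_span
      (fun y => hgen.mem_span_of_mul_mem (by omega) hk) hcon
    have hspan : Ideal.span (f '' Z) ⊔ Ideal.span {f k} =
        Ideal.span (f '' (insert k Z : Finset (Fin s))) := by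
      rw [Finset.coe_insert, Set.image_insert_eq, Ideal.span_insert, sup_comm]
    rw [hspan] at hv hle
    exact hv (hgen.mem_span_of_mul_mem (by rw [Finset.card_insert_of_notMem hk]; omega)
      (by simp [hjk, hj]) (hle _ hy))
  suffices h : ∀ S : Finset (Fin s), Disjoint S Z →
      x ∈ Ideal.span (f '' Z) ⊔ Ideal.span {∏ j ∈ S, f j ^ (m * b)} from
    h _ disjoint_compl_left
  intro S hS
  induction S using Finset.induction_on with
  | empty => simp
  | insert k S hk ih =>
    rw [Finset.disjoint_insert_left] at hS
    obtain ⟨w, hw⟩ := mem_sup_span_singleton_iff.1 (ih hS.2)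
    have hxk := hgen.mem_sup_span_pow_of_mem_starSymbolicPower hf hs hb hc hsum hZ hS.1 hx
    have hwk : w ∈ Ideal.span (f '' Z) ⊔ Ideal.span {f k ^ (m * b)} := by
      refine mem_of_prod_mul_mem S (g := fun j => f j ^ (m * b)) (fun j hjS y hy => ?_)
        ((Submodule.sub_mem_iff_right _ hxk).1 (Ideal.mem_sup_left hw))
      refine mem_of_pow_mul_mem (hreg j k ?_ hS.1 ?_) _ hy
      · exact Finset.disjoint_left.1 hS.2 hjS
      · rintro rfl; exact hk hjS
    obtain ⟨u, hu⟩ := mem_sup_span_singleton_iff.1 hwk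
    refine mem_sup_span_singleton_iff.2 ⟨u, ?_⟩
    rw [Finset.prod_insert hk]
    convert add_mem hw (Ideal.mul_mem_left _ (∏ j ∈ S, f j ^ (m * b)) hu) using 1
    ring

theorem IsCGeneric.not_pow_le_mul_starSymbolicPower (hf : ∀ i, (f i).IsHomogeneous d)
    (hs : n + 1 ≤ s) (hgen : IsCGeneric n f) (hb : b ≠ 0) (hc : c + 1 ≤ n)
    (hsum : a + b * c = s * b) (m : ℕ) :
    ¬ uniformFoldProductIdeal f b a ^ m ≤
      Ideal.span (Set.range f) * starSymbolicPower (uniformFoldProductIdeal f b a) m := by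
  intro hle
  obtain ⟨Z, -, hZ⟩ := Finset.exists_subset_card_eq (s := (Finset.univ : Finset (Fin s))) (n := c)
    (by rw [Finset.card_fin]; omega)
  have hmem := hle (Ideal.pow_mem_pow (prod_compl_mem_uniformFoldProductIdeal (f := f) hsum hZ) m)
  have hpow : (∏ j ∈ Zᶜ, f j ^ b) ^ m = ∏ j ∈ Zᶜ, f j ^ (m * b) := by
    rw [← Finset.prod_pow]
    exact Finset.prod_congr rfl fun j _ => by rw [← pow_mul, mul_comm]
  rw [hpow] at hmem
  have hmem' := Ideal.mul_mono_right (hgen.starSymbolicPower_le_sup hf hs hb hc hsum hZ m) hmem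
  rw [Ideal.mul_sup] at hmem'
  obtain ⟨y, hy, z, hz, hyz⟩ := Submodule.mem_sup.1 hmem'
  obtain ⟨μ, hμ, rfl⟩ := Ideal.mem_mul_span_singleton.1 hz
  have hone : 1 - μ ∈ Ideal.span (f '' Z) := by
    refine mem_of_prod_mul_mem Zᶜ (g := fun j => f j ^ (m * b)) (fun j hj x hx =>
      mem_of_pow_mul_mem (fun x => hgen.mem_span_of_mul_mem (by omega) (Finset.mem_compl.1 hj))
        _ hx) ?_
    have hyZ : y ∈ Ideal.span (f '' Z) :=
      (Ideal.mul_le_right : Ideal.span (Set.range f) * Ideal.span (f '' Z) ≤ _) hy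
    convert hyZ using 1
    linear_combination -hyz
  -- All forms have positive degree, so `1 - μ` and `μ` both have zero constant term.
  have hker : Ideal.span (Set.range f) ≤ RingHom.ker (constantCoeff (R := K)) := by
    rw [Ideal.span_le]
    rintro _ ⟨i, rfl⟩
    exact (hf i).coeff_eq_zero (by simpa using (hgen.degree_ne_zero hf hs).symm)
  have h1 : (1 : MvPolynomial (Fin (n + 1)) K) ∈ RingHom.ker (constantCoeff (R := K)) := by
    rw [← sub_add_cancel 1 μ]
    exact add_mem (hker (Ideal.span_mono (Set.image_subset_range _ _) hone)) (hker hμ)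
  simp at h1

end Main

theorem mainTheorem10 {K : Type*} [Field K] [Infinite K] (n s a b d : ℕ)
    (hb : 1 ≤ b) (hs : n + 1 ≤ s) (ha : b * (s - n) + 1 ≤ a) (ha' : a ≤ s * b)
    (f : Fin s → MvPolynomial (Fin (n + 1)) K)
    (hf : ∀ i, (f i).IsHomogeneous d) (hgen : IsCGeneric n f) :
    List.TFAE [
      ∀ m : ℕ, 1 ≤ m →
        ¬ uniformFoldProductIdeal f b a ^ m ≤
          Ideal.span (Set.range f) * starSymbolicPower (uniformFoldProductIdeal f b a) m,
      ∃ m : ℕ, 1 ≤ m ∧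
        ¬ uniformFoldProductIdeal f b a ^ m ≤
          Ideal.span (Set.range f) * starSymbolicPower (uniformFoldProductIdeal f b a) m,
      b ∣ a] := by
  obtain ⟨c, r, hr, hsum⟩ : ∃ c r, r < b ∧ a + b * c + r = s * b := by
    refine ⟨(s * b - a) / b, (s * b - a) % b, Nat.mod_lt _ hb, ?_⟩
    have := Nat.div_add_mod (s * b - a) b
    omega
  -- The lower bound on `a` enters here: `c ≥ n` would give `a ≤ b * (s - n)`.
  have hc : c + 1 ≤ n := by
    by_contra! hlt
    have h1 : b * n ≤ b * c := Nat.mul_le_mul_left b (by omega)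
    have h2 : b * (s - n) + b * n = s * b := by
      rw [← mul_add, Nat.sub_add_cancel (by omega), mul_comm]
    omega
  tfae_have 1 → 2 := fun h => ⟨1, le_rfl, h 1 le_rfl⟩
  tfae_have 2 → 3 := by
    rintro ⟨m, hm, hnot⟩
    by_contra hdvd
    have hr0 : r ≠ 0 := by
      rintro rfl
      exact hdvd ((Nat.dvd_add_left (dvd_mul_right b c)).1 (hsum ▸ dvd_mul_left b s))
    exact hnot (hgen.pow_le_mul_starSymbolicPower hsum hr hr0 hc hs (by omega) (by omega))
  tfae_have 3 → 1 := by
    intro hdvd m _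
    have hr0 : r = 0 := by
      refine Nat.eq_zero_of_dvd_of_lt ?_ hr
      exact (Nat.dvd_add_right (dvd_add hdvd (dvd_mul_right b c))).1 (hsum ▸ dvd_mul_left b s)
    exact hgen.not_pow_le_mul_starSymbolicPower hf hs (by omega) hc (by rw [← hsum, hr0, add_zero]) m
  tfae_finish
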